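/- Let $\mathfrak X$ be a (real or complex) Banach space and let $\Phi:[0,\infty)\to\mathcal L(\mathfrak X)$ be a function whose values are contractions, $\|\Phi(t)\|\le 1$ for all $t\ge 0$, with $\Phi(0)=\mathbb 1$. Let $\{U_A(t)\}_{t\ge 0}$ be a strongly continuous contraction semigroup on $\mathfrak X$ with generator $A$, in the sign convention $U_A(t)=e^{-tA}$; that is, $Ax=\lim_{t\to+0}\frac1t\,(x-U_A(t)x)$, with $\mathrm{dom}(A)$ the set of all $x\in\mathfrak X$ for which this limit exists in norm. Let $D\subset\mathrm{dom}(A)$ be a core of $A$, i.e. a linear subspace such that the closure of the restriction $A|_D$ is $A$. If $$\lim_{t\to+0}\frac1t\,(\Phi(t)-\mathbb 1)u=-Au\qquad\text{for all }u\in D,$$ then $$\lim_{n\to\infty}[\Phi(t/n)]^n x=U_A(t)x\qquad\text{for all }t\ge 0\text{ and all }x\in\mathfrak X,$$ the limits being taken in the norm of $\mathfrak X$. -/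

import Mathlib

open Filter Topology
open scoped NNReal

/-- A contraction semigroup on a normed space `X`: a strongly continuous one-parameter semigroup
`(U t)`, `t ≥ 0`, of bounded linear operators of norm at most one. -/
structure ContractionSemigroup (𝕜 X : Type*) [RCLike 𝕜] [NormedAddCommGroup X]
    [NormedSpace 𝕜 X] where
  toFun : ℝ≥0 → X →L[𝕜] X
  map_zero' : toFun 0 = 1
  map_add' : ∀ s t : ℝ≥0, toFun (s + t) = toFun s * toFun t
  norm_le_one' : ∀ t : ℝ≥0, ‖toFun t‖ ≤ 1
  continuous' : ∀ x : X, Continuous fun t : ℝ≥0 => toFun t x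

namespace ContractionSemigroup

variable {𝕜 X : Type*} [RCLike 𝕜] [NormedAddCommGroup X] [NormedSpace 𝕜 X]

instance : CoeFun (ContractionSemigroup 𝕜 X) fun _ => ℝ≥0 → X →L[𝕜] X := ⟨toFun⟩

/-- The difference quotient `t⁻¹ (x - U t x)`. -/
def diffQuot (U : ContractionSemigroup 𝕜 X) (x : X) (t : ℝ≥0) : X :=
  (((t : ℝ) : 𝕜))⁻¹ • (x - U t x)

/-- `y = lim_{t → 0+} t⁻¹ (x - U t x)`, the limit being taken in norm. -/
def HasGeneratorAt (U : ContractionSemigroup 𝕜 X) (x y : X) : Prop :=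
  Tendsto (U.diffQuot x) (𝓝[>] 0) (𝓝 y)

theorem HasGeneratorAt.unique {U : ContractionSemigroup 𝕜 X} {x y z : X}
    (hy : U.HasGeneratorAt x y) (hz : U.HasGeneratorAt x z) : y = z :=
  tendsto_nhds_unique hy hz

theorem HasGeneratorAt.add {U : ContractionSemigroup 𝕜 X} {x x' y y' : X}
    (h : U.HasGeneratorAt x y) (h' : U.HasGeneratorAt x' y') :
    U.HasGeneratorAt (x + x') (y + y') := by
  refine (Tendsto.add h h').congr fun t => ?_
  simp only [diffQuot, map_add, ← smul_add]
  congr 1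
  abel

theorem HasGeneratorAt.smul {U : ContractionSemigroup 𝕜 X} {x y : X} (c : 𝕜)
    (h : U.HasGeneratorAt x y) : U.HasGeneratorAt (c • x) (c • y) := by
  refine (Tendsto.const_smul h c).congr fun t => ?_
  simp only [diffQuot, map_smul, ← smul_sub]
  rw [smul_comm]

theorem hasGeneratorAt_zero (U : ContractionSemigroup 𝕜 X) : U.HasGeneratorAt 0 0 := by
  refine tendsto_const_nhds.congr fun t => ?_
  simp [diffQuot]

/-- The generator `A` of the semigroup, with the sign convention `U t = exp (-t A)`:
`A x = lim_{t → 0+} t⁻¹ (x - U t x)`, defined on the subspace of all `x` for which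
this limit exists. -/
noncomputable def generator (U : ContractionSemigroup 𝕜 X) : X →ₗ.[𝕜] X where
  domain :=
    { carrier := {x | ∃ y, U.HasGeneratorAt x y}
      add_mem' := fun ⟨y, hy⟩ ⟨z, hz⟩ => ⟨y + z, hy.add hz⟩
      zero_mem' := ⟨0, U.hasGeneratorAt_zero⟩
      smul_mem' := fun c _ ⟨y, hy⟩ => ⟨c • y, hy.smul c⟩ }
  toFun :=
    { toFun := fun x => x.2.choose
      map_add' := fun x y =>
        (x + y).2.choose_spec.unique (x.2.choose_spec.add y.2.choose_spec)
      map_smul' := fun c x => (c • x).2.choose_spec.unique (x.2.choose_spec.smul c) }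

end ContractionSemigroup

/-! Split the `n` steps of length `h = t/n` into `N` blocks of `m = n/N` steps (rounded down), with
`N` fixed while `n → ∞`. On `dom(A)`, with `τ = t/N`, both `Φ(h)^m x` and `U(τ)x` equal `x - τAx` up
to a small multiple of `τ`. For `Φ` this rests on `norm_pow_apply_sub_add_smul_le`; the core enters
only through approximation in the graph norm. As `U` is contractive and commutes with `A`, one `N`
serves the whole orbit of `x`, so telescoping over the blocks gives a small total error. Density of
`dom(A)` and contractivity give all `x`. -/

namespace ContractionSemigroup

variable {𝕜 X : Type*} [RCLike 𝕜] [NormedAddCommGroup X] [NormedSpace 𝕜 X]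

/-! ### Generator: invariance and density of its domain. -/

theorem mem_graph_generator_iff {U : ContractionSemigroup 𝕜 X} {x a : X} :
    (x, a) ∈ U.generator.graph ↔ U.HasGeneratorAt x a := by
  rw [LinearPMap.mem_graph_iff]
  constructor
  · rintro ⟨y, rfl, rfl⟩
    exact y.2.choose_spec
  · intro h
    exact ⟨⟨x, a, h⟩, rfl, (Exists.choose_spec (⟨a, h⟩ : ∃ y, U.HasGeneratorAt x y)).unique h⟩

theorem norm_apply_le (U : ContractionSemigroup 𝕜 X) (s : ℝ≥0) (x : X) : ‖U s x‖ ≤ ‖x‖ :=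
  (U s).le_of_opNorm_le (U.norm_le_one' s) x |>.trans_eq (one_mul _)

/-- The semigroup commutes with its generator. -/
theorem HasGeneratorAt.map {U : ContractionSemigroup 𝕜 X} {x a : X}
    (h : U.HasGeneratorAt x a) (s : ℝ≥0) : U.HasGeneratorAt (U s x) (U s a) := by
  refine (((U s).continuous.tendsto a).comp h).congr fun t => ?_
  have hc : U s (U t x) = U t (U s x) := by
    rw [← mul_apply_eq_comp, ← mul_apply_eq_comp, ← U.map_add', ← U.map_add', add_comm]
  simp [diffQuot, hc]

/-- Applying `U t` translates the interval of integration, so the difference quotient reduces to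
averages over `[0, t]` and `[r, r + t]`. -/
theorem hasGeneratorAt_integral [CompleteSpace X] [NormedSpace ℝ X] [IsScalarTower ℝ 𝕜 X]
    (U : ContractionSemigroup 𝕜 X) (x : X) (r : ℝ≥0) :
    U.HasGeneratorAt (∫ s in (0 : ℝ)..r, U s.toNNReal x) (x - U r x) := by
  have hf : Continuous fun s : ℝ => U s.toNNReal x := (U.continuous' x).comp continuous_real_toNNReal
  set f : ℝ → X := fun s => U s.toNNReal x with hfdef
  have hF (a : ℝ) : HasDerivAt (fun b => ∫ s in (0 : ℝ)..b, f s) (f a) a :=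
    hf.integral_hasStrictDerivAt 0 a |>.hasDerivAt
  have h0 := (hF 0).tendsto_slope_zero_right
  have hr := (hF r).tendsto_slope_zero_right
  have hcoe : Tendsto (fun t : ℝ≥0 => (t : ℝ)) (𝓝[>] 0) (𝓝[>] 0) := by
    refine tendsto_nhdsWithin_iff.2 ⟨?_, ?_⟩
    · exact (NNReal.continuous_coe.tendsto 0).mono_left nhdsWithin_le_nhds
    · filter_upwards [self_mem_nhdsWithin] with t ht
      exact_mod_cast ht
  have hlim := (h0.sub hr).comp hcoe
  have e : f 0 - f r = x - U r x := by simp [hfdef, U.map_zero']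
  rw [e] at hlim
  refine hlim.congr fun t => ?_
  have hii (a b : ℝ) : IntervalIntegrable f MeasureTheory.volume a b := hf.intervalIntegrable a b
  have hU : U t (∫ s in (0 : ℝ)..r, f s) = ∫ s in (t : ℝ)..r + t, f s := by
    rw [← ContinuousLinearMap.intervalIntegral_comp_comm (U t) (hii 0 r)]
    have : ∫ s in (t : ℝ)..r + t, f s = ∫ s in (0 : ℝ)..r, f (s + t) := by
      simp [intervalIntegral.integral_comp_add_right]
    rw [this]
    refine intervalIntegral.integral_congr fun s hs => ?_
    rw [Set.uIcc_of_le (NNReal.coe_nonneg r)] at hs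
    simp only [hfdef]
    rw [Real.toNNReal_add hs.1 (NNReal.coe_nonneg t), Real.toNNReal_coe, add_comm, U.map_add']
    rfl
  have hsplit : (∫ s in (0 : ℝ)..t, f s) - ((∫ s in (0 : ℝ)..r + t, f s) - ∫ s in (0 : ℝ)..r, f s)
      = (∫ s in (0 : ℝ)..r, f s) - ∫ s in (t : ℝ)..r + t, f s := by
    rw [← intervalIntegral.integral_interval_sub_left (hii 0 (r + t)) (hii 0 t)]
    abel
  simp only [Function.comp, zero_add, intervalIntegral.integral_same, sub_zero, diffQuot]
  rw [hU, ← hsplit, ← smul_sub, ← algebraMap_smul 𝕜, map_inv₀, RCLike.algebraMap_eq_ofReal]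

theorem exists_hasGeneratorAt_norm_sub_lt [CompleteSpace X] (U : ContractionSemigroup 𝕜 X)
    (x : X) {ε : ℝ} (hε : 0 < ε) : ∃ y a, U.HasGeneratorAt y a ∧ ‖x - y‖ < ε := by
  let : NormedSpace ℝ X := NormedSpace.restrictScalars ℝ 𝕜 X
  have : IsScalarTower ℝ 𝕜 X := IsScalarTower.restrictScalars ℝ 𝕜 X
  have hf : Continuous fun s : ℝ => U s.toNNReal x := (U.continuous' x).comp continuous_real_toNNReal
  have h0 := (hf.integral_hasStrictDerivAt 0 0).hasDerivAt.tendsto_slope_zero_right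
  simp only [Real.toNNReal_zero, U.map_zero', one_apply_eq_self, zero_add,
    intervalIntegral.integral_same, sub_zero] at h0
  obtain ⟨r, hr, hr0⟩ :=
    ((Metric.tendsto_nhds.1 h0 ε hε).and self_mem_nhdsWithin).exists
  have hg := (U.hasGeneratorAt_integral x ⟨r, le_of_lt hr0⟩).smul ((r : 𝕜)⁻¹)
  refine ⟨_, _, hg, ?_⟩
  rw [dist_comm, dist_eq_norm, ← algebraMap_smul 𝕜, map_inv₀] at hr
  exact hr

end ContractionSemigroup

theorem LinearPMap.HasCore.graph_le_topologicalClosure {R E F : Type*} [CommRing R]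
    [AddCommGroup E] [AddCommGroup F] [Module R E] [Module R F] [TopologicalSpace E]
    [TopologicalSpace F] [ContinuousAdd E] [ContinuousAdd F] [TopologicalSpace R]
    [ContinuousSMul R E] [ContinuousSMul R F] {f : E →ₗ.[R] F} {S : Submodule R E}
    (h : f.HasCore S) : f.graph ≤ (f.domRestrict S).graph.topologicalClosure := by
  by_cases hc : (f.domRestrict S).IsClosable
  · rw [hc.graph_closure_eq_closure_graph, h.closure_eq]
  -- By convention a non-closable map is its own closure, so here the restriction is already `f`.
  · have he := h.closure_eq
    rw [LinearPMap.closure_def' hc] at he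
    rw [he]
    exact f.graph.le_topologicalClosure

/-! ### Powers of contractions. -/

section Contraction

variable {𝕜 X : Type*} [RCLike 𝕜] [NormedAddCommGroup X] [NormedSpace 𝕜 X]

theorem ContinuousLinearMap.norm_pow_apply_le {T : X →L[𝕜] X} (hT : ‖T‖ ≤ 1) (m : ℕ) (x : X) :
    ‖(T ^ m) x‖ ≤ ‖x‖ := by
  induction m with
  | zero => simp
  | succ m ih =>
    rw [pow_succ', mul_apply_eq_comp]
    exact ((T.le_of_opNorm_le hT _).trans_eq (one_mul _)).trans ih

theorem ContinuousLinearMap.norm_pow_apply_sub_le {T : X →L[𝕜] X} (hT : ‖T‖ ≤ 1) (m : ℕ) (y : X) :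
    ‖(T ^ m) y - y‖ ≤ m * ‖T y - y‖ := by
  induction m with
  | zero => simp
  | succ m ih =>
    have e : (T ^ (m + 1)) y - y = (T ^ m) (T y - y) + ((T ^ m) y - y) := by
      rw [pow_succ, mul_apply_eq_comp, map_sub]; abel
    rw [e]
    refine (norm_add_le _ _).trans ?_
    have := norm_pow_apply_le hT m (T y - y)
    rw [Nat.cast_succ]
    linarith

/-- The left side is `∑ T^k (T u - u + c a) - c ∑ (T^k a - a)` over `k < m`. Since `T a - a` need
not be of order `c`, `a` is traded for a `y` on which `T - 1` is small. -/
theorem ContinuousLinearMap.norm_pow_apply_sub_add_smul_le {T : X →L[𝕜] X} (hT : ‖T‖ ≤ 1)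
    (m : ℕ) (c : 𝕜) (u a y : X) :
    ‖(T ^ m) u - u + ((m : 𝕜) * c) • a‖ ≤
      m * ‖T u - u + c • a‖ + m * ‖c‖ * (2 * ‖a - y‖ + m * ‖T y - y‖) := by
  induction m with
  | zero => simp
  | succ m ih =>
    have e : (T ^ (m + 1)) u - u + (((m + 1 : ℕ) : 𝕜) * c) • a =
        (T ^ m) (T u - u + c • a) + ((T ^ m) u - u + ((m : 𝕜) * c) • a) -
          c • ((T ^ m) a - a) := by
      rw [pow_succ, mul_apply_eq_comp, map_add, map_sub, map_smul]
      rw [Nat.cast_succ]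
      module
    have e' : (T ^ m) a - a = (T ^ m) (a - y) + ((T ^ m) y - y) - (a - y) := by
      rw [map_sub]; abel
    have h1 : ‖(T ^ m) a - a‖ ≤ 2 * ‖a - y‖ + m * ‖T y - y‖ := by
      rw [e']
      refine (norm_sub_le _ _).trans ?_
      have := norm_add_le ((T ^ m) (a - y)) ((T ^ m) y - y)
      have := norm_pow_apply_le hT m (a - y)
      have := norm_pow_apply_sub_le hT m y
      linarith
    have h2 : ‖c • ((T ^ m) a - a)‖ ≤ ‖c‖ * (2 * ‖a - y‖ + m * ‖T y - y‖) := by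
      rw [norm_smul]; gcongr
    have h3 := norm_pow_apply_le hT m (T u - u + c • a)
    rw [e]
    refine (norm_sub_le _ _).trans ?_
    have h4 := norm_add_le ((T ^ m) (T u - u + c • a)) ((T ^ m) u - u + ((m : 𝕜) * c) • a)
    have h5 : (0 : ℝ) ≤ (m + 1) * ‖c‖ * ‖T y - y‖ := by positivity
    rw [Nat.cast_succ]
    nlinarith

/-- Telescoping estimate for the powers of two contractions. -/
theorem ContinuousLinearMap.norm_pow_apply_sub_pow_apply_le {S : X →L[𝕜] X} (hS : ‖S‖ ≤ 1)
    (V : X →L[𝕜] X) (x : X) (N : ℕ) :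
    ‖(S ^ N) x - (V ^ N) x‖ ≤ ∑ j ∈ Finset.range N, ‖S ((V ^ j) x) - V ((V ^ j) x)‖ := by
  induction N with
  | zero => simp
  | succ N ih =>
    have e : (S ^ (N + 1)) x - (V ^ (N + 1)) x =
        S ((S ^ N) x - (V ^ N) x) + (S ((V ^ N) x) - V ((V ^ N) x)) := by
      rw [pow_succ', pow_succ', mul_apply_eq_comp, mul_apply_eq_comp, map_sub]; abel
    rw [e, Finset.sum_range_succ]
    refine (norm_add_le _ _).trans (add_le_add ?_ le_rfl)
    exact ((S.le_of_opNorm_le hS _).trans_eq (one_mul _)).trans ih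

end Contraction

/-! ### First-order expansion of a block of `Φ`. -/

section Approximation

variable {𝕜 X : Type*} [RCLike 𝕜] [NormedAddCommGroup X] [NormedSpace 𝕜 X]

theorem ContinuousLinearMap.tendsto_apply_of_norm_le_one {ι : Type*} {l : Filter ι}
    {S : ι → X →L[𝕜] X} (hS : ∀ i, ‖S i‖ ≤ 1) {V : X →L[𝕜] X} (hV : ‖V‖ ≤ 1) {x : X}
    (h : ∀ ε > 0, ∃ y, ‖x - y‖ < ε ∧ Tendsto (fun i => S i y) l (𝓝 (V y))) :
    Tendsto (fun i => S i x) l (𝓝 (V x)) := by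
  refine Metric.tendsto_nhds.2 fun ε hε => ?_
  obtain ⟨y, hxy, hy⟩ := h (ε / 3) (by positivity)
  filter_upwards [Metric.tendsto_nhds.1 hy (ε / 3) (by positivity)] with i hi
  rw [dist_eq_norm] at hi ⊢
  have e : S i x - V x = S i (x - y) + (S i y - V y) - V (x - y) := by
    rw [map_sub, map_sub]; abel
  have h1 := ((S i).le_of_opNorm_le (hS i) (x - y)).trans_eq (one_mul _)
  have h2 := (V.le_of_opNorm_le hV (x - y)).trans_eq (one_mul _)
  have h3 := norm_sub_le (S i (x - y) + (S i y - V y)) (V (x - y))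
  have h4 := norm_add_le (S i (x - y)) (S i y - V y)
  rw [e]
  linarith

theorem NNReal.tendsto_div_natCast_nhdsGT_zero {t : ℝ≥0} (ht : 0 < t) :
    Tendsto (fun n : ℕ => t / n) atTop (𝓝[>] 0) := by
  refine tendsto_nhdsWithin_iff.2 ⟨?_, ?_⟩
  · rw [← NNReal.tendsto_coe]
    simpa using tendsto_const_div_atTop_nhds_zero_nat (t : ℝ)
  · filter_upwards [eventually_gt_atTop 0] with n hn
    have : (0 : ℝ≥0) < n := by exact_mod_cast hn
    exact div_pos ht this

theorem tendsto_natDiv_mul_div_atTop (t : ℝ) (N : ℕ) :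
    Tendsto (fun n : ℕ => ((n / N : ℕ) : ℝ) * (t / n)) atTop (𝓝 (t / N)) := by
  have h := (tendsto_nat_floor_mul_div_atTop (R := ℝ) (a := (N : ℝ)⁻¹) (by positivity)).comp
    tendsto_natCast_atTop_atTop
  have h' := h.mul_const t
  rw [inv_mul_eq_div] at h'
  refine h'.congr fun n => ?_
  simp only [Function.comp]
  rw [inv_mul_eq_div, Nat.floor_div_eq_div]
  ring

variable {Φ : ℝ≥0 → X →L[𝕜] X}

theorem tendsto_apply_of_tendsto_diffQuot {d b : X}
    (hd : Tendsto (fun t : ℝ≥0 => (((t : ℝ) : 𝕜))⁻¹ • (Φ t d - d)) (𝓝[>] 0) (𝓝 (-b))) :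
    Tendsto (fun t : ℝ≥0 => Φ t d) (𝓝[>] 0) (𝓝 d) := by
  have h0 : Tendsto (fun t : ℝ≥0 => ((t : ℝ) : 𝕜)) (𝓝[>] 0) (𝓝 0) := by
    have : Continuous fun t : ℝ≥0 => ((t : ℝ) : 𝕜) :=
      RCLike.continuous_ofReal.comp NNReal.continuous_coe
    simpa using (this.tendsto 0).mono_left nhdsWithin_le_nhds
  have h := (h0.smul hd).add_const d
  rw [zero_smul, zero_add] at h
  refine h.congr' ?_
  filter_upwards [self_mem_nhdsWithin] with t ht
  have : ((t : ℝ) : 𝕜) ≠ 0 := by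
    rw [RCLike.ofReal_ne_zero]; exact_mod_cast (ne_of_gt ht)
  rw [smul_inv_smul₀ this, sub_add_cancel]

theorem eventually_norm_pow_apply_sub_add_smul_lt (hΦ : ∀ t, ‖Φ t‖ ≤ 1) {d b d' b' : X}
    (hd : Tendsto (fun t : ℝ≥0 => (((t : ℝ) : 𝕜))⁻¹ • (Φ t d - d)) (𝓝[>] 0) (𝓝 (-b)))
    (hd' : Tendsto (fun t : ℝ≥0 => (((t : ℝ) : 𝕜))⁻¹ • (Φ t d' - d')) (𝓝[>] 0) (𝓝 (-b')))
    {t : ℝ≥0} (ht : 0 < t) (N : ℕ) {ε : ℝ} (hε : 0 < ε) :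
    ∀ᶠ n : ℕ in atTop,
      ‖(Φ (t / n) ^ (n / N)) d - d + ((t / N : ℝ) : 𝕜) • b‖ <
        (t / N) * (2 * ‖b - d'‖ + (t / N) * ‖b'‖) + ε := by
  have hh := NNReal.tendsto_div_natCast_nhdsGT_zero ht
  have hm := tendsto_natDiv_mul_div_atTop (t : ℝ) N
  have h1 := ((hd.comp hh).add_const b).norm
  have h2 := (hd'.comp hh).norm
  rw [neg_add_cancel, norm_zero] at h1
  rw [norm_neg] at h2
  -- Rounding makes `m h` differ from `t/N`; this term absorbs the discrepancy.
  have h3 := ((hm.const_sub (t / N : ℝ)).norm).mul_const ‖b‖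
  rw [sub_self, norm_zero, zero_mul] at h3
  have hR := ((hm.mul h1).add (hm.mul ((hm.mul h2).const_add (2 * ‖b - d'‖)))).add h3
  rw [mul_zero, zero_add, add_zero] at hR
  filter_upwards [hR.eventually_lt_const (lt_add_of_pos_right _ hε), eventually_gt_atTop 0]
    with n hn hn0
  refine lt_of_le_of_lt ?_ hn
  simp only [Function.comp]
  set h : ℝ≥0 := t / n with hdef
  set m : ℕ := n / N
  have hh0 : (0 : ℝ) < h := by
    have : (0 : ℝ≥0) < n := by exact_mod_cast hn0
    exact_mod_cast div_pos ht this
  have hcoe : (t : ℝ) / n = h := by simp [hdef]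
  have hne : ((h : ℝ) : 𝕜) ≠ 0 := by rw [RCLike.ofReal_ne_zero]; exact hh0.ne'
  have hnorm : ‖((h : ℝ) : 𝕜)‖ = h := by rw [RCLike.norm_ofReal, abs_of_pos hh0]
  rw [hcoe]
  have key := ContinuousLinearMap.norm_pow_apply_sub_add_smul_le (hΦ h) m ((h : ℝ) : 𝕜) d b d'
  have e1 : ‖Φ h d - d + ((h : ℝ) : 𝕜) • b‖ =
      h * ‖(((h : ℝ) : 𝕜))⁻¹ • (Φ h d - d) + b‖ := by
    nth_rewrite 2 [← hnorm]
    rw [← norm_smul, smul_add, smul_inv_smul₀ hne]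
  have e2 : ‖Φ h d' - d'‖ = h * ‖(((h : ℝ) : 𝕜))⁻¹ • (Φ h d' - d')‖ := by
    nth_rewrite 1 [← smul_inv_smul₀ hne (Φ h d' - d')]
    rw [norm_smul, hnorm]
  have e3 : (Φ h ^ m) d - d + ((t / N : ℝ) : 𝕜) • b =
      ((Φ h ^ m) d - d + ((m : 𝕜) * ((h : ℝ) : 𝕜)) • b) +
        ((t / N - m * h : ℝ) : 𝕜) • b := by
    rw [RCLike.ofReal_sub, RCLike.ofReal_mul, RCLike.ofReal_natCast, sub_smul]
    abel
  have h4 : ‖((t / N - m * h : ℝ) : 𝕜) • b‖ = ‖(t / N - m * h : ℝ)‖ * ‖b‖ := by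
    rw [norm_smul, RCLike.norm_ofReal, Real.norm_eq_abs]
  rw [e1, e2, hnorm] at key
  rw [e3]
  refine (norm_add_le _ _).trans ?_
  rw [h4]
  refine add_le_add (key.trans_eq ?_) le_rfl
  ring

/-- Contractivity of the powers makes the estimate stable under graph-norm limits in both pairs. -/
theorem eventually_norm_pow_apply_sub_add_smul_lt_of_approx (hΦ : ∀ t, ‖Φ t‖ ≤ 1) {x a y c : X}
    (hx : ∀ ε > 0, ∃ d b, Tendsto (fun t : ℝ≥0 => (((t : ℝ) : 𝕜))⁻¹ • (Φ t d - d)) (𝓝[>] 0)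
      (𝓝 (-b)) ∧ ‖x - d‖ < ε ∧ ‖a - b‖ < ε)
    (hy : ∀ ε > 0, ∃ d b, Tendsto (fun t : ℝ≥0 => (((t : ℝ) : 𝕜))⁻¹ • (Φ t d - d)) (𝓝[>] 0)
      (𝓝 (-b)) ∧ ‖y - d‖ < ε ∧ ‖c - b‖ < ε)
    {t : ℝ≥0} (ht : 0 < t) (N : ℕ) {ε : ℝ} (hε : 0 < ε) :
    ∀ᶠ n : ℕ in atTop,
      ‖(Φ (t / n) ^ (n / N)) x - x + ((t / N : ℝ) : 𝕜) • a‖ <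
        (t / N) * (2 * ‖a - y‖ + (t / N) * ‖c‖) + ε := by
  set τ : ℝ := t / N with hτdef
  have hτ : 0 ≤ τ := by positivity
  -- The replacements cost `2δ` for `x`, `τδ` for `a`, and `τ(4δ + τδ)` inside the bound.
  set δ : ℝ := ε / 2 / (2 + 5 * τ + τ * τ) with hδdef
  have hδ : 0 < δ := by positivity
  have hδε : δ * (2 + 5 * τ + τ * τ) = ε / 2 := by rw [hδdef]; field_simp
  obtain ⟨d, b, hd, hxd, hab⟩ := hx δ hδ
  obtain ⟨d', b', hd', hyd, hcb⟩ := hy δ hδ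
  filter_upwards [eventually_norm_pow_apply_sub_add_smul_lt hΦ hd hd' ht N (half_pos hε)]
    with n hn
  rw [← hτdef] at hn
  set S : X →L[𝕜] X := Φ (t / n) ^ (n / N) with hS
  have e : S x - x + (τ : 𝕜) • a =
      (S d - d + (τ : 𝕜) • b) + (S (x - d) - (x - d)) + (τ : 𝕜) • (a - b) := by
    rw [map_sub, smul_sub]; abel
  have h1 : ‖S (x - d)‖ ≤ ‖x - d‖ := ContinuousLinearMap.norm_pow_apply_le (hΦ _) _ _
  have h2 : ‖(τ : 𝕜) • (a - b)‖ = τ * ‖a - b‖ := by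
    rw [norm_smul, RCLike.norm_ofReal, abs_of_nonneg hτ]
  have h3 : ‖b - d'‖ ≤ ‖a - y‖ + 2 * δ := by
    have e' : b - d' = (a - y) + (y - d') - (a - b) := by abel
    have := norm_sub_le ((a - y) + (y - d')) (a - b)
    have := norm_add_le (a - y) (y - d')
    rw [e']; linarith
  have h4 : ‖b'‖ ≤ ‖c‖ + δ := by
    have := norm_sub_le c (c - b')
    rw [sub_sub_cancel] at this
    linarith
  have h5 : τ * (2 * ‖b - d'‖ + τ * ‖b'‖) ≤ τ * (2 * (‖a - y‖ + 2 * δ) + τ * (‖c‖ + δ)) := by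
    gcongr
  have h6 : τ * ‖a - b‖ ≤ τ * δ := by gcongr
  rw [e]
  have h7 := norm_add_le ((S d - d + (τ : 𝕜) • b) + (S (x - d) - (x - d))) ((τ : 𝕜) • (a - b))
  have h8 := norm_add_le (S d - d + (τ : 𝕜) • b) (S (x - d) - (x - d))
  have h9 := norm_sub_le (S (x - d)) (x - d)
  linarith

end Approximation

/-! ### Comparison with the semigroup. -/

namespace ContractionSemigroup

variable {𝕜 X : Type*} [RCLike 𝕜] [NormedAddCommGroup X] [NormedSpace 𝕜 X]

theorem pow_eq (U : ContractionSemigroup 𝕜 X) (s : ℝ≥0) (j : ℕ) : U s ^ j = U (j * s) := by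
  induction j with
  | zero => simp [U.map_zero']
  | succ j ih => rw [pow_succ, ih, ← U.map_add', Nat.cast_succ, add_one_mul]

theorem exists_core_approx {Φ : ℝ≥0 → X →L[𝕜] X} {U : ContractionSemigroup 𝕜 X}
    {D : Submodule 𝕜 X} (hD : U.generator.HasCore D)
    (hderiv : ∀ u : U.generator.domain, (u : X) ∈ D →
      Tendsto (fun t : ℝ≥0 => (((t : ℝ) : 𝕜))⁻¹ • ((Φ t - 1) (u : X))) (𝓝[>] 0)
        (𝓝 (-U.generator u)))
    {x a : X} (h : U.HasGeneratorAt x a) {ε : ℝ} (hε : 0 < ε) :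
    ∃ d b, Tendsto (fun t : ℝ≥0 => (((t : ℝ) : 𝕜))⁻¹ • (Φ t d - d)) (𝓝[>] 0) (𝓝 (-b)) ∧
      ‖x - d‖ < ε ∧ ‖a - b‖ < ε := by
  have hmem := hD.graph_le_topologicalClosure (mem_graph_generator_iff.2 h)
  rw [← SetLike.mem_coe, Submodule.topologicalClosure_coe] at hmem
  obtain ⟨⟨d, b⟩, hdb, hdist⟩ := Metric.mem_closure_iff.1 hmem ε hε
  obtain ⟨u, hu, hub⟩ := (LinearPMap.mem_graph_iff _).1 hdb
  rw [Prod.dist_eq, max_lt_iff, dist_eq_norm, dist_eq_norm] at hdist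
  have hu2 : (u : X) ∈ D ⊓ U.generator.domain := u.2
  rw [Submodule.mem_inf] at hu2
  have hval : U.generator.domRestrict D u = U.generator ⟨u, hu2.2⟩ :=
    LinearPMap.domRestrict_apply rfl
  have := hderiv ⟨u, hu2.2⟩ hu2.1
  rw [← hval, hub] at this
  simp only at hu
  refine ⟨d, b, ?_, hdist⟩
  rw [← hu]
  exact this

/-- Over a sufficiently short time step, the powers of `Φ` follow the orbit of a vector in the
domain of the generator up to a small multiple of the step, uniformly along the orbit. -/
theorem HasGeneratorAt.exists_eventually_norm_pow_apply_sub_le [CompleteSpace X]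
    {Φ : ℝ≥0 → X →L[𝕜] X} (hΦ : ∀ t, ‖Φ t‖ ≤ 1) {U : ContractionSemigroup 𝕜 X}
    (happ : ∀ x a, U.HasGeneratorAt x a → ∀ ε > 0, ∃ d b,
      Tendsto (fun t : ℝ≥0 => (((t : ℝ) : 𝕜))⁻¹ • (Φ t d - d)) (𝓝[>] 0) (𝓝 (-b)) ∧
        ‖x - d‖ < ε ∧ ‖a - b‖ < ε)
    {x a : X} (hx : U.HasGeneratorAt x a) {t : ℝ≥0} (ht : 0 < t) {ε : ℝ} (hε : 0 < ε) :
    ∃ N : ℕ, 0 < N ∧ ∀ s, ∀ᶠ n : ℕ in atTop,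
      ‖(Φ (t / n) ^ (n / N)) (U s x) - U (t / N) (U s x)‖ ≤ 5 * ε * (t / N) := by
  -- `a` need not lie in the domain, so a nearby `y` that does takes its place.
  obtain ⟨y, c, hy, hay⟩ := U.exists_hasGeneratorAt_norm_sub_lt a hε
  have hh := NNReal.tendsto_div_natCast_nhdsGT_zero ht
  have h1 : Tendsto (fun N : ℕ => (t / N : ℝ) * ‖c‖) atTop (𝓝 0) := by
    simpa using (tendsto_const_div_atTop_nhds_zero_nat (t : ℝ)).mul_const ‖c‖
  -- `N` is fixed before `s`: both conditions are imposed at `x` and transported by the contraction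
  -- `U s`.
  obtain ⟨N, ⟨hN1, hN2⟩, hN0⟩ := ((h1.eventually_lt_const hε).and
    (Metric.tendsto_nhds.1 (hx.comp hh) ε hε)).and (eventually_gt_atTop 0) |>.exists
  refine ⟨N, hN0, fun s => ?_⟩
  have hNR : (0 : ℝ) < N := by exact_mod_cast hN0
  have hτ : (0 : ℝ) < t / N := div_pos (by exact_mod_cast ht) hNR
  have hcoe : ((t / N : ℝ≥0) : ℝ) = (t : ℝ) / N := by simp
  simp only [Function.comp, diffQuot, dist_eq_norm, hcoe] at hN2
  set τ : ℝ := (t : ℝ) / N with hτdef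
  have hne : (τ : 𝕜) ≠ 0 := by rw [RCLike.ofReal_ne_zero]; exact hτ.ne'
  have hloc : ‖x - (τ : 𝕜) • a - U (t / N) x‖ ≤ τ * ε := by
    have e : x - (τ : 𝕜) • a - U (t / N) x =
        (τ : 𝕜) • ((τ : 𝕜)⁻¹ • (x - U (t / N) x) - a) := by
      rw [smul_sub, smul_inv_smul₀ hne]; abel
    rw [e, norm_smul, RCLike.norm_ofReal, abs_of_pos hτ]
    gcongr
  filter_upwards [eventually_norm_pow_apply_sub_add_smul_lt_of_approx hΦ
    (happ _ _ (hx.map s)) (happ _ _ (hy.map s)) ht N (mul_pos hτ hε)] with n hn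
  rw [← hτdef] at hn
  have hcomm : U (t / N) (U s x) = U s (U (t / N) x) := by
    rw [← mul_apply_eq_comp, ← mul_apply_eq_comp, ← U.map_add', ← U.map_add', add_comm]
  have e : (Φ (t / n) ^ (n / N)) (U s x) - U (t / N) (U s x) =
      ((Φ (t / n) ^ (n / N)) (U s x) - U s x + (τ : 𝕜) • U s a) +
        U s (x - (τ : 𝕜) • a - U (t / N) x) := by
    rw [hcomm, map_sub, map_sub, map_smul]; abel
  rw [e]
  refine (norm_add_le _ _).trans ?_
  have h2 := (U.norm_apply_le s (x - (τ : 𝕜) • a - U (t / N) x)).trans hloc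
  have h3 : ‖U s a - U s y‖ ≤ ε := by
    rw [← map_sub]; exact (U.norm_apply_le s _).trans hay.le
  have h4 : τ * ‖U s c‖ ≤ ε :=
    (mul_le_mul_of_nonneg_left (U.norm_apply_le s c) hτ.le).trans hN1.le
  -- Three of the five `ε τ`; the others are the slack in `hn` and the local error of `U`.
  have h5 : τ * (2 * ‖U s a - U s y‖ + τ * ‖U s c‖) ≤ τ * (2 * ε + ε) := by gcongr
  linarith

theorem HasGeneratorAt.tendsto_pow_apply [CompleteSpace X]
    {Φ : ℝ≥0 → X →L[𝕜] X} (hΦ : ∀ t, ‖Φ t‖ ≤ 1) {U : ContractionSemigroup 𝕜 X}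
    (happ : ∀ x a, U.HasGeneratorAt x a → ∀ ε > 0, ∃ d b,
      Tendsto (fun t : ℝ≥0 => (((t : ℝ) : 𝕜))⁻¹ • (Φ t d - d)) (𝓝[>] 0) (𝓝 (-b)) ∧
        ‖x - d‖ < ε ∧ ‖a - b‖ < ε)
    {x a : X} (hx : U.HasGeneratorAt x a) {t : ℝ≥0} (ht : 0 < t) :
    Tendsto (fun n : ℕ => (Φ (t / n) ^ n) x) atTop (𝓝 (U t x)) := by
  have hΦx : Tendsto (fun n : ℕ => Φ (t / n) x) atTop (𝓝 x) := by
    refine ContinuousLinearMap.tendsto_apply_of_norm_le_one (V := 1) (fun _ => hΦ _)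
      ContinuousLinearMap.norm_id_le fun ε hε => ?_
    obtain ⟨d, b, hd, hxd, -⟩ := happ x a hx ε hε
    exact ⟨d, hxd, (tendsto_apply_of_tendsto_diffQuot hd).comp
      (NNReal.tendsto_div_natCast_nhdsGT_zero ht)⟩
  refine Metric.tendsto_nhds.2 fun ε hε => ?_
  have ht' : (0 : ℝ) < t := by exact_mod_cast ht
  -- `N` blocks at `5 · ε/(10t) · t/N` each cost `ε/2`; the other half covers the `n % N` leftover
  -- steps, fewer than `N`, each moving `x` little.
  obtain ⟨N, hN, hblock⟩ := hx.exists_eventually_norm_pow_apply_sub_le hΦ happ ht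
    (ε := ε / (10 * t)) (by positivity)
  have hNR : (0 : ℝ) < N := by exact_mod_cast hN
  have hall : ∀ᶠ n : ℕ in atTop, ∀ j ∈ Finset.range N,
      ‖(Φ (t / n) ^ (n / N)) (U (j * (t / N)) x) - U (t / N) (U (j * (t / N)) x)‖ ≤
        5 * (ε / (10 * t)) * (t / N) :=
    (Finset.eventually_all _).2 fun j _ => hblock _
  filter_upwards [hall, Metric.tendsto_nhds.1 hΦx (ε / (2 * N)) (by positivity)] with n hn hn'
  rw [dist_eq_norm] at hn' ⊢
  set T := Φ (t / n) with hT
  have hSnorm : ‖T ^ (n / N)‖ ≤ 1 :=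
    ContinuousLinearMap.opNorm_le_bound _ zero_le_one fun z =>
      (ContinuousLinearMap.norm_pow_apply_le (hΦ _) _ z).trans_eq (one_mul _).symm
  have hUt : U t = U (t / N) ^ N := by
    rw [U.pow_eq, mul_div_cancel₀]
    exact_mod_cast hN.ne'
  have hTn : T ^ n = (T ^ (n / N)) ^ N * T ^ (n % N) := by
    rw [← pow_mul, ← pow_add, mul_comm, Nat.div_add_mod]
  have e : (T ^ n) x - U t x =
      ((T ^ (n / N)) ^ N) ((T ^ (n % N)) x - x) +
        (((T ^ (n / N)) ^ N) x - (U (t / N) ^ N) x) := by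
    rw [hTn, hUt, mul_apply_eq_comp, map_sub]; abel
  have h1 : ‖((T ^ (n / N)) ^ N) ((T ^ (n % N)) x - x)‖ < ε / 2 := by
    refine (ContinuousLinearMap.norm_pow_apply_le hSnorm _ _).trans_lt ?_
    refine (ContinuousLinearMap.norm_pow_apply_sub_le (hΦ _) _ _).trans_lt ?_
    have hmod : ((n % N : ℕ) : ℝ) ≤ N := by exact_mod_cast (Nat.mod_lt n hN).le
    calc ((n % N : ℕ) : ℝ) * ‖T x - x‖ ≤ N * ‖T x - x‖ := by gcongr
      _ < N * (ε / (2 * N)) := by gcongr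
      _ = ε / 2 := by field_simp
  have h2 : ‖((T ^ (n / N)) ^ N) x - (U (t / N) ^ N) x‖ ≤ ε / 2 := by
    refine (ContinuousLinearMap.norm_pow_apply_sub_pow_apply_le hSnorm _ _ _).trans ?_
    calc _ ≤ ∑ _j ∈ Finset.range N, 5 * (ε / (10 * t)) * (t / N) := by
          refine Finset.sum_le_sum fun j hj => ?_
          rw [U.pow_eq]
          exact hn j hj
      _ = ε / 2 := by
          rw [Finset.sum_const, Finset.card_range, nsmul_eq_mul]
          field_simp
          norm_num
  rw [e]
  exact (norm_add_le _ _).trans_lt (by linarith)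

end ContractionSemigroup

theorem theorem2 {𝕜 X : Type*} [RCLike 𝕜] [NormedAddCommGroup X] [NormedSpace 𝕜 X]
    [CompleteSpace X]
    (Φ : ℝ≥0 → X →L[𝕜] X) (hΦ : ∀ t, ‖Φ t‖ ≤ 1) (hΦ0 : Φ 0 = 1)
    (U : ContractionSemigroup 𝕜 X)
    (D : Submodule 𝕜 X) (hD : U.generator.HasCore D)
    (hderiv : ∀ u : U.generator.domain, (u : X) ∈ D →
      Tendsto (fun t : ℝ≥0 => (((t : ℝ) : 𝕜))⁻¹ • ((Φ t - 1) (u : X))) (𝓝[>] 0)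
        (𝓝 (-U.generator u)))
    (t : ℝ≥0) (x : X) :
    Tendsto (fun n : ℕ => ((Φ (t / n)) ^ n) x) atTop (𝓝 (U t x)) := by
  rcases eq_or_ne t 0 with rfl | ht
  · simp [hΦ0, U.map_zero']
  have hpow (n : ℕ) : ‖Φ (t / n) ^ n‖ ≤ 1 :=
    ContinuousLinearMap.opNorm_le_bound _ zero_le_one fun z =>
      (ContinuousLinearMap.norm_pow_apply_le (hΦ _) _ z).trans_eq (one_mul _).symm
  refine ContinuousLinearMap.tendsto_apply_of_norm_le_one hpow (U.norm_le_one' t) fun ε hε => ?_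
  obtain ⟨y, a, hy, hxy⟩ := U.exists_hasGeneratorAt_norm_sub_lt x hε
  exact ⟨y, hxy, hy.tendsto_pow_apply hΦ
    (fun _ _ h _ hε => ContractionSemigroup.exists_core_approx hD hderiv h hε)
    (pos_iff_ne_zero.2 ht)⟩
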